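/- Let $1\le p<\infty$ and let $\mathbb{D}$ be the open unit disc of $\mathbb{C}$. Let $H^p(\mathbb{D})$ be the Hardy space of all holomorphic $f:\mathbb{D}\to\mathbb{C}$ with $$\|f\|_p=\Bigl(\sup_{0<r<1}\frac1{2\pi}\int_0^{2\pi}|f(re^{i\theta})|^p\,d\theta\Bigr)^{1/p}<\infty .$$ A bounded linear operator $T$ on a complex Banach space $X$ has the positive shadowing property if for every $\varepsilon>0$ there is $\delta>0$ such that for every sequence $(x_n)_{n\ge1}$ in $X$ with $\|Tx_n-x_{n+1}\|\le\delta$ for all $n\ge1$ there is $x\in X$ with $\|T^nx-x_n\|\le\varepsilon$ for all $n\ge1$. Let $\phi:\mathbb{D}\to\mathbb{D}$ be holomorphic. If $\phi$ has a fixed point in $\mathbb{D}$, then the (bounded) composition operator $C_\phi f=f\circ\phi$ does not have the positive shadowing property on $H^p(\mathbb{D})$. -/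

import Mathlib

noncomputable section

open Metric Set Real MeasureTheory

namespace HardyDisc

/-- The integral mean `(1 / 2π) ∫₀^{2π} |f (r e^{iθ})|^p dθ`. -/
def integralMean (p : ℝ) (f : ℂ → ℂ) (r : ℝ) : ℝ :=
  Real.circleAverage (fun z => ‖f z‖ ^ p) 0 r

/-- Membership in `H^p(𝔻)`: `f` is holomorphic on the open unit disc and its integral means over
the circles of radius `0 < r < 1` are bounded. A function on the disc is represented by its
extension by zero to `ℂ`, so that two members are equal iff they agree on the disc. -/
def MemHardy (p : ℝ) (f : ℂ → ℂ) : Prop :=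
  DifferentiableOn ℂ f (ball 0 1) ∧ (∀ z ∉ ball (0 : ℂ) 1, f z = 0) ∧
    BddAbove (integralMean p f '' Ioo 0 1)

/-- The norm `‖f‖_p = (sup_{0 < r < 1} (1 / 2π) ∫₀^{2π} |f (r e^{iθ})|^p dθ)^{1/p}`. -/
def hardyNorm (p : ℝ) (f : ℂ → ℂ) : ℝ :=
  (sSup (integralMean p f '' Ioo 0 1)) ^ (1 / p)

section Auxiliary

variable {p : ℝ} {f g : ℂ → ℂ} {r R : ℝ}

lemma sphere_subset (h0 : 0 < r) (h1 : r < 1) : sphere (0 : ℂ) |r| ⊆ ball 0 1 := by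
  intro z hz
  rw [abs_of_pos h0, mem_sphere_zero_iff_norm] at hz
  simpa [hz] using h1

lemma circleMap_mem (h0 : 0 < r) (h1 : r < 1) (θ : ℝ) : circleMap 0 r θ ∈ ball (0 : ℂ) 1 := by
  simpa [abs_of_pos h0] using h1

lemma continuous_circle (hf : DifferentiableOn ℂ f (ball 0 1)) (h0 : 0 < r) (h1 : r < 1) :
    Continuous fun θ => f (circleMap 0 r θ) :=
  hf.continuousOn.comp_continuous (continuous_circleMap 0 r) (circleMap_mem h0 h1)

lemma continuousOn_rpow (hp : 1 ≤ p) (hf : DifferentiableOn ℂ f (ball 0 1)) :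
    ContinuousOn (fun z => ‖f z‖ ^ p) (ball 0 1) :=
  hf.continuousOn.norm.rpow_const fun _ _ => Or.inr (by linarith)

lemma integralMean_nonneg : 0 ≤ integralMean p f r :=
  Real.circleAverage_nonneg_of_nonneg fun _ _ => by positivity

lemma integralMean_le (hf : MemHardy p f) (h0 : 0 < r) (h1 : r < 1) :
    integralMean p f r ≤ sSup (integralMean p f '' Ioo 0 1) :=
  le_csSup hf.2.2 ⟨r, ⟨h0, h1⟩, rfl⟩

lemma sSup_nonneg' : 0 ≤ sSup (integralMean p f '' Ioo 0 1) :=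
  Real.sSup_nonneg (by rintro _ ⟨r, _, rfl⟩; exact integralMean_nonneg)

lemma hardyNorm_nonneg : 0 ≤ hardyNorm p f := Real.rpow_nonneg sSup_nonneg' _

lemma hardyNorm_rpow (hp : 1 ≤ p) : hardyNorm p f ^ p = sSup (integralMean p f '' Ioo 0 1) := by
  rw [hardyNorm, ← Real.rpow_mul sSup_nonneg', one_div, inv_mul_cancel₀ (by linarith),
    Real.rpow_one]

lemma integralMean_le_norm (hp : 1 ≤ p) (hf : MemHardy p f) (h0 : 0 < r) (h1 : r < 1) :
    integralMean p f r ≤ hardyNorm p f ^ p :=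
  (integralMean_le hf h0 h1).trans (hardyNorm_rpow hp).ge

lemma hardyNorm_le_of (hp : 1 ≤ p) {C : ℝ} (hC : 0 ≤ C)
    (h : ∀ r, 0 < r → r < 1 → integralMean p f r ≤ C ^ p) : hardyNorm p f ≤ C := by
  have h2 : sSup (integralMean p f '' Ioo 0 1) ≤ C ^ p :=
    Real.sSup_le (by rintro _ ⟨r, hr, rfl⟩; exact h r hr.1 hr.2) (by positivity)
  calc hardyNorm p f ≤ (C ^ p) ^ (1 / p) :=
        Real.rpow_le_rpow sSup_nonneg' h2 (by positivity)
    _ = C := by rw [← Real.rpow_mul hC, mul_one_div_cancel (by linarith), Real.rpow_one]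

/-- Minkowski's inequality for the integral means. -/
lemma integralMean_add (hp : 1 ≤ p) (hf : DifferentiableOn ℂ f (ball 0 1))
    (hg : DifferentiableOn ℂ g (ball 0 1)) (h0 : 0 < r) (h1 : r < 1) :
    integralMean p (f + g) r ^ (1 / p) ≤
      integralMean p f r ^ (1 / p) + integralMean p g r ^ (1 / p) := by
  set q : ENNReal := ENNReal.ofReal p with hq
  have hp0 : 0 < p := by linarith
  have hqr : q.toReal = p := ENNReal.toReal_ofReal hp0.le
  have hq1 : 1 ≤ q := by rw [hq]; exact ENNReal.one_le_ofReal.2 hp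
  set μ : Measure ℝ := volume.restrict (Ioc 0 (2 * π)) with hμ
  have hmem : ∀ h : ℂ → ℂ, DifferentiableOn ℂ h (ball 0 1) →
      MemLp (fun θ => h (circleMap 0 r θ)) q μ := by
    intro h hh
    have hc := continuous_circle hh h0 h1
    obtain ⟨C, hC⟩ := (isCompact_Icc (a := (0 : ℝ)) (b := 2 * π)).exists_bound_of_continuousOn
      hc.continuousOn
    refine MemLp.of_bound hc.aestronglyMeasurable C ?_
    refine (ae_restrict_iff' measurableSet_Ioc).2 (ae_of_all _ fun θ hθ => ?_)
    exact hC θ ⟨hθ.1.le, hθ.2⟩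
  have key : ∀ h : ℂ → ℂ, DifferentiableOn ℂ h (ball 0 1) →
      integralMean p h r ^ (1 / p) = ((2 * π)⁻¹) ^ (1 / p) *
        (eLpNorm (fun θ => h (circleMap 0 r θ)) q μ).toReal := by
    intro h hh
    rw [(hmem h hh).eLpNorm_eq_integral_rpow_norm (by positivity) (by simp [hq]), hqr,
      ENNReal.toReal_ofReal (by positivity), integralMean, Real.circleAverage_def,
      intervalIntegral.integral_of_le (by positivity), smul_eq_mul,
      Real.mul_rpow (by positivity) (integral_nonneg fun _ => by positivity), one_div]
  rw [key _ hf, key _ hg, key _ (hf.add hg), ← mul_add]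
  refine mul_le_mul_of_nonneg_left ?_ (by positivity)
  rw [← ENNReal.toReal_add (hmem f hf).2.ne (hmem g hg).2.ne]
  exact ENNReal.toReal_mono (ENNReal.add_ne_top.2 ⟨(hmem f hf).2.ne, (hmem g hg).2.ne⟩)
    (eLpNorm_add_le (hmem f hf).1 (hmem g hg).1 hq1)

lemma integralMean_add_le (hp : 1 ≤ p) (hf : MemHardy p f) (hg : MemHardy p g)
    (h0 : 0 < r) (h1 : r < 1) :
    integralMean p (f + g) r ≤ (hardyNorm p f + hardyNorm p g) ^ p := by
  have h := integralMean_add hp hf.1 hg.1 h0 h1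
  have hp0 : 0 < p := by linarith
  have e : ∀ {h : ℂ → ℂ}, MemHardy p h → integralMean p h r ^ (1 / p) ≤ hardyNorm p h :=
    fun hh => Real.rpow_le_rpow integralMean_nonneg (integralMean_le hh h0 h1) (by positivity)
  have h2 := h.trans (add_le_add (e hf) (e hg))
  calc integralMean p (f + g) r = (integralMean p (f + g) r ^ (1 / p)) ^ p := by
        rw [← Real.rpow_mul integralMean_nonneg, one_div, inv_mul_cancel₀ hp0.ne', Real.rpow_one]
    _ ≤ _ := Real.rpow_le_rpow (Real.rpow_nonneg integralMean_nonneg _) h2 hp0.le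

lemma memHardy_add (hp : 1 ≤ p) (hf : MemHardy p f) (hg : MemHardy p g) : MemHardy p (f + g) := by
  refine ⟨hf.1.add hg.1, fun z hz => by simp [hf.2.1 z hz, hg.2.1 z hz], ?_⟩
  refine ⟨(hardyNorm p f + hardyNorm p g) ^ p, ?_⟩
  rintro _ ⟨r, hr, rfl⟩
  exact integralMean_add_le hp hf hg hr.1 hr.2

lemma integralMean_smul (c : ℂ) :
    integralMean p (c • f) r = ‖c‖ ^ p * integralMean p f r := by
  simp only [integralMean, Pi.smul_apply, norm_smul,
    Real.mul_rpow (norm_nonneg _) (norm_nonneg _)]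
  exact Real.circleAverage_fun_smul (a := ‖c‖ ^ p) (f := fun z => ‖f z‖ ^ p)

lemma hardyNorm_smul_le (hp : 1 ≤ p) (hf : MemHardy p f) (c : ℂ) :
    hardyNorm p (c • f) ≤ ‖c‖ * hardyNorm p f := by
  refine hardyNorm_le_of hp (mul_nonneg (norm_nonneg _) hardyNorm_nonneg) fun r h0 h1 => ?_
  rw [integralMean_smul, Real.mul_rpow (norm_nonneg _) hardyNorm_nonneg]
  exact mul_le_mul_of_nonneg_left (integralMean_le_norm hp hf h0 h1) (by positivity)

lemma memHardy_smul (hp : 1 ≤ p) (c : ℂ) (hf : MemHardy p f) : MemHardy p (c • f) := by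
  refine ⟨hf.1.const_smul c, fun z hz => by simp [hf.2.1 z hz], ?_⟩
  refine ⟨‖c‖ ^ p * hardyNorm p f ^ p, ?_⟩
  rintro _ ⟨r, hr, rfl⟩
  rw [integralMean_smul]
  exact mul_le_mul_of_nonneg_left (integralMean_le_norm hp hf hr.1 hr.2) (by positivity)

lemma integralMean_zero (hp : 1 ≤ p) : integralMean p 0 r = 0 := by
  simp [integralMean, Real.zero_rpow (show p ≠ 0 by linarith), Real.circleAverage_def]

lemma memHardy_zero (hp : 1 ≤ p) : MemHardy p 0 := by
  refine ⟨differentiableOn_const 0, fun _ _ => rfl, 0, ?_⟩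
  rintro _ ⟨r, _, rfl⟩
  exact (integralMean_zero hp).le

/-- The Poisson majorant of `|f|^p` on the disc of radius `R`, as the real part of a holomorphic
function. -/
def majorant (p : ℝ) (f : ℂ → ℂ) (R : ℝ) (w : ℂ) : ℂ :=
  Real.circleAverage (fun ζ => herglotzRieszKernel 0 w ζ • ((‖f ζ‖ ^ p : ℝ) : ℂ)) 0 R

lemma circleIntegrable_rpow (hp : 1 ≤ p) (hf : DifferentiableOn ℂ f (ball 0 1))
    (h0 : 0 < R) (h1 : R < 1) : CircleIntegrable (fun z => ‖f z‖ ^ p) 0 R :=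
  ((continuousOn_rpow hp hf).mono (sphere_subset h0 h1)).circleIntegrable'

lemma majorant_re (hp : 1 ≤ p) (hf : DifferentiableOn ℂ f (ball 0 1)) (h0 : 0 < R) (h1 : R < 1)
    {w : ℂ} (hw : w ∈ ball 0 R) : (majorant p f R w).re =
      Real.circleAverage (fun z => (herglotzRieszKernel 0 w z).re * ‖f z‖ ^ p) 0 R :=
  re_circleAverage_herglotzRieszKernel_smul (circleIntegrable_rpow hp hf h0 h1) hw

lemma majorant_differentiableOn (hp : 1 ≤ p) (hf : DifferentiableOn ℂ f (ball 0 1))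
    (h0 : 0 < R) (h1 : R < 1) : DifferentiableOn ℂ (majorant p f R) (ball 0 R) := by
  refine differentiableOn_circleAverage_herglotzRieszKernel_smul
    (f := fun ζ => ((‖f ζ‖ ^ p : ℝ) : ℂ)) ?_
  exact (Complex.continuous_ofReal.comp_continuousOn
    ((continuousOn_rpow hp hf).mono (sphere_subset h0 h1))).circleIntegrable'

lemma continuousOn_kernel {w : ℂ} (hw : w ∈ ball 0 R) :
    ContinuousOn (fun z => (herglotzRieszKernel 0 w z).re) (sphere 0 |R|) :=
  Complex.continuous_re.comp_continuousOn (continuousOn_herglotzRieszKernel_sphere hw)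

lemma kernel_nonneg (h0 : 0 < R) {w z : ℂ} (hw : w ∈ ball 0 R) (hz : z ∈ sphere 0 |R|) :
    0 ≤ (herglotzRieszKernel 0 w z).re := by
  rw [abs_of_pos h0] at hz
  refine le_trans ?_ (le_re_herglotzRieszKernel hz hw)
  have : ‖w - 0‖ < R := mem_ball_iff_norm.1 hw
  exact div_nonneg (by linarith) (by positivity)

lemma majorant_re_le (hp : 1 ≤ p) (hf : DifferentiableOn ℂ f (ball 0 1)) (h0 : 0 < R) (h1 : R < 1)
    {w : ℂ} (hw : w ∈ ball 0 R) :
    (majorant p f R w).re ≤ (R + ‖w‖) / (R - ‖w‖) * integralMean p f R := by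
  have hc := (continuousOn_rpow hp hf).mono (sphere_subset h0 h1)
  rw [majorant_re hp hf h0 h1 hw]
  have e : (R + ‖w‖) / (R - ‖w‖) * integralMean p f R =
      Real.circleAverage (fun z => (R + ‖w‖) / (R - ‖w‖) * ‖f z‖ ^ p) 0 R :=
    (Real.circleAverage_fun_smul (a := (R + ‖w‖) / (R - ‖w‖)) (f := fun z => ‖f z‖ ^ p)).symm
  rw [e]
  refine Real.circleAverage_mono ((continuousOn_kernel hw).mul hc).circleIntegrable'
    (continuousOn_const.mul hc).circleIntegrable' fun z hz => ?_
  rw [abs_of_pos h0] at hz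
  refine mul_le_mul_of_nonneg_right ?_ (by positivity)
  simpa [herglotzRieszKernel_def] using re_herglotzRieszKernel_le hz hw

/-- `|f|^p` is dominated by its Poisson majorant. -/
lemma rpow_le_majorant (hp : 1 ≤ p) (hf : DifferentiableOn ℂ f (ball 0 1))
    (h0 : 0 < R) (h1 : R < 1) {w : ℂ} (hw : w ∈ ball 0 R) :
    ‖f w‖ ^ p ≤ (majorant p f R w).re := by
  have hp0 : 0 < p := by linarith
  have hs := sphere_subset h0 h1
  have hc := (continuousOn_rpow hp hf).mono hs
  have hk := continuousOn_kernel hw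
  have hn := hf.continuousOn.norm.mono hs
  rw [majorant_re hp hf h0 h1 hw]
  rcases (norm_nonneg (f w)).eq_or_lt with hb | hb
  · rw [← hb, Real.zero_rpow hp0.ne']
    exact Real.circleAverage_nonneg_of_nonneg fun z hz =>
      mul_nonneg (kernel_nonneg h0 hw hz) (by positivity)
  have hone : Real.circleAverage (fun z => (herglotzRieszKernel 0 w z).re) 0 R = 1 := by
    have h := DiffContOnCl.circleAverage_re_herglotzRieszKernel_smul (f := fun _ : ℂ => (1 : ℂ))
      (c := 0) (R := R) (w := w) diffContOnCl_const hw
    have hci : CircleIntegrable ((Complex.re ∘ herglotzRieszKernel 0 w) • fun _ : ℂ => (1 : ℂ))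
        0 R := (hk.smul continuousOn_const).circleIntegrable'
    have h2 := Complex.reCLM.circleAverage_comp_comm hci
    rw [h] at h2
    rw [← Complex.one_re, ← Complex.reCLM_apply, ← h2]
    congr 1
    ext z
    simp
  have hmean : ‖f w‖ ≤ Real.circleAverage (fun z => (herglotzRieszKernel 0 w z).re * ‖f z‖) 0 R := by
    have hd : DiffContOnCl ℂ f (ball 0 R) := by
      refine (hf.mono ?_).diffContOnCl
      rw [closure_ball _ h0.ne']
      exact closedBall_subset_ball h1
    have h := hd.circleAverage_re_herglotzRieszKernel_smul hw
    rw [← h, Real.circleAverage_def, Real.circleAverage_def, norm_smul, smul_eq_mul,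
      Real.norm_of_nonneg (by positivity)]
    refine mul_le_mul_of_nonneg_left ?_ (by positivity)
    refine (intervalIntegral.norm_integral_le_integral_norm (by positivity)).trans_eq ?_
    refine intervalIntegral.integral_congr fun θ _ => ?_
    have := kernel_nonneg h0 hw (circleMap_mem_sphere' (0 : ℂ) R θ)
    simp [abs_of_nonneg this]
  set b := ‖f w‖ with hbdef
  have hint1 : CircleIntegrable
      (fun z => (b ^ p * (p / b)) • ((herglotzRieszKernel 0 w z).re * ‖f z‖)) 0 R :=
    ((continuousOn_const (c := b ^ p * (p / b))).smul (hk.mul hn)).circleIntegrable'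
  have hint2 : CircleIntegrable
      (fun z => (b ^ p * (1 - p)) • (herglotzRieszKernel 0 w z).re) 0 R :=
    ((continuousOn_const (c := b ^ p * (1 - p))).smul hk).circleIntegrable'
  have e1 : Real.circleAverage (fun z => (b ^ p * (p / b)) •
      ((herglotzRieszKernel 0 w z).re * ‖f z‖) +
        (b ^ p * (1 - p)) • (herglotzRieszKernel 0 w z).re) 0 R =
      b ^ p * (p / b) * Real.circleAverage
        (fun z => (herglotzRieszKernel 0 w z).re * ‖f z‖) 0 R + b ^ p * (1 - p) := by
    rw [Real.circleAverage_fun_add hint1 hint2, Real.circleAverage_fun_smul,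
      Real.circleAverage_fun_smul, hone]
    simp
  have e2 : b ^ p ≤ b ^ p * (p / b) * Real.circleAverage
        (fun z => (herglotzRieszKernel 0 w z).re * ‖f z‖) 0 R + b ^ p * (1 - p) := by
    have : b ^ p * (p / b) * b ≤ b ^ p * (p / b) * Real.circleAverage
        (fun z => (herglotzRieszKernel 0 w z).re * ‖f z‖) 0 R :=
      mul_le_mul_of_nonneg_left hmean (by positivity)
    have h3 : b ^ p * (p / b) * b = b ^ p * p := by field_simp
    linarith
  rw [← e1] at e2
  refine e2.trans (Real.circleAverage_mono (hint1.add hint2)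
    (hk.mul hc).circleIntegrable' fun z hz => ?_)
  have hK := kernel_nonneg h0 hw hz
  have hB : 1 + p * (‖f z‖ / b - 1) ≤ (‖f z‖ / b) ^ p := by
    have h4 : 0 ≤ ‖f z‖ / b := by positivity
    simpa using one_add_mul_self_le_rpow_one_add (s := ‖f z‖ / b - 1) (by linarith) hp
  rw [Real.div_rpow (norm_nonneg _) hb.le, le_div_iff₀ (by positivity)] at hB
  have := mul_le_mul_of_nonneg_left hB hK
  simp only [smul_eq_mul]
  refine le_trans (le_of_eq ?_) this
  field_simp
  ring

lemma rpow_le_integralMean (hp : 1 ≤ p) (hf : DifferentiableOn ℂ f (ball 0 1))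
    (h0 : 0 < R) (h1 : R < 1) {w : ℂ} (hw : w ∈ ball 0 R) :
    ‖f w‖ ^ p ≤ (R + ‖w‖) / (R - ‖w‖) * integralMean p f R :=
  (rpow_le_majorant hp hf h0 h1 hw).trans (majorant_re_le hp hf h0 h1 hw)

lemma eq_zero_of_hardyNorm (hp : 1 ≤ p) (hf : MemHardy p f) (h : hardyNorm p f = 0) : f = 0 := by
  ext w
  by_cases hw : w ∈ ball (0 : ℂ) 1
  · have hw1 : ‖w‖ < 1 := by simpa using hw
    obtain ⟨R, hR0, hR1⟩ := exists_between hw1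
    have hRp : 0 < R := (norm_nonneg w).trans_lt hR0
    have h1 := rpow_le_integralMean hp hf.1 hRp hR1 (by simpa using hR0)
    have h2 := integralMean_le_norm hp hf hRp hR1
    rw [h, Real.zero_rpow (by linarith)] at h2
    rw [le_antisymm h2 integralMean_nonneg, mul_zero] at h1
    have h3 := (Real.rpow_eq_zero (norm_nonneg (f w)) (by linarith)).1
      (le_antisymm h1 (by positivity))
    simpa using h3
  · exact hf.2.1 w hw

/-- Littlewood's subordination principle: composition with a holomorphic self-map of the disc
increases the integral means by at most a constant factor. -/
lemma integralMean_comp_le (hp : 1 ≤ p) (hf : MemHardy p f) {φ : ℂ → ℂ}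
    (hφ : DifferentiableOn ℂ φ (ball 0 1)) (hm : MapsTo φ (ball 0 1) (ball 0 1))
    (h0 : 0 < r) (h1 : r < 1) :
    integralMean p (f ∘ φ) r ≤ 4 / (1 - ‖φ 0‖) * hardyNorm p f ^ p := by
  have hsub : closedBall (0 : ℂ) r ⊆ ball 0 1 := closedBall_subset_ball h1
  obtain ⟨z₀, hz₀, hmax⟩ := (isCompact_closedBall (0 : ℂ) r).exists_isMaxOn
    ⟨0, by simpa using h0.le⟩ (hφ.continuousOn.norm.mono hsub)
  have hφz : ∀ z ∈ ball (0 : ℂ) 1, ‖φ z‖ < 1 := fun z hz => by simpa using hm hz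
  have hφ0 : ‖φ 0‖ < 1 := hφz 0 (by simp)
  obtain ⟨R, hR0, hR1⟩ : ∃ R, max ‖φ z₀‖ ((1 + ‖φ 0‖) / 2) < R ∧ R < 1 :=
    exists_between (max_lt (hφz _ (hsub hz₀)) (by linarith))
  obtain ⟨hRa, hRb⟩ := max_lt_iff.1 hR0
  have hRp : 0 < R := (norm_nonneg _).trans_lt hRa
  have hmR : MapsTo φ (closedBall 0 r) (ball 0 R) := fun z hz => by
    simpa using lt_of_le_of_lt (hmax hz) hRa
  have hG := (majorant_differentiableOn hp hf.1 hRp hR1).comp (hφ.mono hsub) hmR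
  have hGc : DiffContOnCl ℂ (majorant p f R ∘ φ) (ball 0 |r|) := by
    refine DifferentiableOn.diffContOnCl ?_
    rwa [abs_of_pos h0, closure_ball _ h0.ne']
  have hsr : sphere (0 : ℂ) |r| ⊆ closedBall 0 r := by
    rw [abs_of_pos h0]; exact sphere_subset_closedBall
  have hmv : Real.circleAverage (fun z => (majorant p f R (φ z)).re) 0 r =
      (majorant p f R (φ 0)).re := by
    have h := hGc.circleAverage
    have h2 := Complex.reCLM.circleAverage_comp_comm (f := majorant p f R ∘ φ) (c := 0) (R := r)
      (hG.continuousOn.mono hsr).circleIntegrable'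
    rw [h] at h2
    exact h2
  have hfφ : DifferentiableOn ℂ (f ∘ φ) (ball 0 1) := hf.1.comp hφ hm
  have hφ0R : φ 0 ∈ ball (0 : ℂ) R := hmR (by simpa using h0.le)
  calc integralMean p (f ∘ φ) r
      ≤ Real.circleAverage (fun z => (majorant p f R (φ z)).re) 0 r := by
        refine Real.circleAverage_mono (circleIntegrable_rpow hp hfφ h0 h1)
          (Complex.continuous_re.comp_continuousOn
            (hG.continuousOn.mono hsr)).circleIntegrable' fun z hz => ?_
        exact rpow_le_majorant hp hf.1 hRp hR1 (hmR (hsr hz))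
    _ = (majorant p f R (φ 0)).re := hmv
    _ ≤ (R + ‖φ 0‖) / (R - ‖φ 0‖) * integralMean p f R := majorant_re_le hp hf.1 hRp hR1 hφ0R
    _ ≤ 4 / (1 - ‖φ 0‖) * hardyNorm p f ^ p := by
        have h5 : 0 < R - ‖φ 0‖ := by linarith
        refine mul_le_mul ?_ (integralMean_le_norm hp hf hRp hR1) integralMean_nonneg
          (div_nonneg (by norm_num) (by linarith))
        rw [div_le_div_iff₀ h5 (by linarith)]
        nlinarith [norm_nonneg (φ 0)]

lemma integralMean_indicator (h0 : 0 < r) (h1 : r < 1) :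
    integralMean p ((ball 0 1).indicator f) r = integralMean p f r :=
  Real.circleAverage_congr_sphere fun z hz => by
    simp [indicator_of_mem (sphere_subset h0 h1 hz)]

lemma memHardy_comp (hp : 1 ≤ p) (hf : MemHardy p f) {φ : ℂ → ℂ}
    (hφ : DifferentiableOn ℂ φ (ball 0 1)) (hm : MapsTo φ (ball 0 1) (ball 0 1)) :
    MemHardy p ((ball 0 1).indicator (f ∘ φ)) := by
  refine ⟨(hf.1.comp hφ hm).congr fun z hz => indicator_of_mem hz _,
    fun z hz => indicator_of_notMem hz _, 4 / (1 - ‖φ 0‖) * hardyNorm p f ^ p, ?_⟩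
  rintro _ ⟨r, hr, rfl⟩
  rw [integralMean_indicator hr.1 hr.2]
  exact integralMean_comp_le hp hf hφ hm hr.1 hr.2

lemma hardyNorm_comp_le (hp : 1 ≤ p) (hf : MemHardy p f) {φ : ℂ → ℂ}
    (hφ : DifferentiableOn ℂ φ (ball 0 1)) (hm : MapsTo φ (ball 0 1) (ball 0 1)) :
    hardyNorm p ((ball 0 1).indicator (f ∘ φ)) ≤
      (4 / (1 - ‖φ 0‖)) ^ (1 / p) * hardyNorm p f := by
  have hφ0 : ‖φ 0‖ < 1 := by simpa using hm (show (0 : ℂ) ∈ ball 0 1 by simp)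
  have hC : 0 ≤ 4 / (1 - ‖φ 0‖) := div_nonneg (by norm_num) (by linarith)
  refine hardyNorm_le_of hp (mul_nonneg (by positivity) hardyNorm_nonneg) fun r h0 h1 => ?_
  rw [integralMean_indicator h0 h1, Real.mul_rpow (by positivity) hardyNorm_nonneg,
    ← Real.rpow_mul hC, one_div, inv_mul_cancel₀ (by linarith), Real.rpow_one]
  exact integralMean_comp_le hp hf hφ hm h0 h1

end Auxiliary

/-- `H^p(𝔻)` as a linear space of functions. -/
def hardySubmodule (p : ℝ) [hp : Fact (1 ≤ p)] : Submodule ℂ (ℂ → ℂ) where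
  carrier := {f | MemHardy p f}
  add_mem' := memHardy_add hp.out
  zero_mem' := memHardy_zero hp.out
  smul_mem' c _ := memHardy_smul hp.out c

/-- The Hardy space `H^p(𝔻)`, `1 ≤ p < ∞`, with the norm `hardyNorm p`. (A separate type, so that
it carries the topology of this norm and not the one of pointwise convergence.) -/
def HardySpace (p : ℝ) [Fact (1 ≤ p)] : Type := hardySubmodule p

namespace HardySpace

variable {p : ℝ} [hp : Fact (1 ≤ p)]

instance : AddCommGroup (HardySpace p) := inferInstanceAs (AddCommGroup (hardySubmodule p))

instance : Module ℂ (HardySpace p) := inferInstanceAs (Module ℂ (hardySubmodule p))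

instance : CoeFun (HardySpace p) fun _ => ℂ → ℂ := ⟨fun f => f.1⟩

instance : Norm (HardySpace p) := ⟨fun f => hardyNorm p f⟩

lemma normCore : NormedSpace.Core ℂ (HardySpace p) where
  norm_nonneg _ := hardyNorm_nonneg
  norm_smul c f := by
    refine le_antisymm (hardyNorm_smul_le hp.out f.2 c) ?_
    rcases eq_or_ne c 0 with rfl | hc
    · rw [norm_zero, zero_mul]; exact hardyNorm_nonneg
    · have h := hardyNorm_smul_le hp.out (memHardy_smul hp.out c f.2) c⁻¹
      rw [smul_smul, inv_mul_cancel₀ hc, one_smul, norm_inv] at h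
      have h2 := mul_le_mul_of_nonneg_left h (norm_nonneg c)
      rwa [mul_inv_cancel_left₀ (norm_ne_zero_iff.2 hc)] at h2
  norm_triangle f g := hardyNorm_le_of hp.out (add_nonneg hardyNorm_nonneg hardyNorm_nonneg)
    fun _ h0 h1 => integralMean_add_le hp.out f.2 g.2 h0 h1
  norm_eq_zero_iff f := by
    refine ⟨fun h => Subtype.ext (eq_zero_of_hardyNorm hp.out f.2 h), ?_⟩
    rintro rfl
    refine le_antisymm (hardyNorm_le_of hp.out le_rfl fun r _ _ => ?_) hardyNorm_nonneg
    exact (integralMean_zero hp.out).le.trans (by positivity)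

instance : NormedAddCommGroup (HardySpace p) := NormedAddCommGroup.ofCore normCore

instance : NormedSpace ℂ (HardySpace p) := NormedSpace.ofCore normCore

end HardySpace

/-- The composition operator `C_φ f = f ∘ φ` on `H^p(𝔻)` induced by a holomorphic self-map `φ` of
the open unit disc, as a bounded linear operator. -/
def compositionOperator (p : ℝ) [hp : Fact (1 ≤ p)] (φ : ℂ → ℂ)
    (hφ : DifferentiableOn ℂ φ (ball 0 1)) (hm : MapsTo φ (ball 0 1) (ball 0 1)) :
    HardySpace p →L[ℂ] HardySpace p :=
  LinearMap.mkContinuous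
    { toFun := fun f => ⟨(ball 0 1).indicator (f ∘ φ), memHardy_comp hp.out f.2 hφ hm⟩
      map_add' := fun f g => Subtype.ext (indicator_add (ball 0 1) (f ∘ φ) (g ∘ φ))
      map_smul' := fun c f => Subtype.ext (indicator_const_smul (ball 0 1) c (f ∘ φ)) }
    ((4 / (1 - ‖φ 0‖)) ^ (1 / p)) fun f => hardyNorm_comp_le hp.out f.2 hφ hm

end HardyDisc

section Shadowing

variable {X : Type*} [NormedAddCommGroup X] [NormedSpace ℂ X]

/-- `(x n)`, `n ≥ 1`, is a `δ`-pseudo-orbit of `T`; the value `x 0` plays no role. -/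
def IsPseudoOrbit (T : X →L[ℂ] X) (δ : ℝ) (x : ℕ → X) : Prop :=
  ∀ n, 1 ≤ n → ‖T (x n) - x (n + 1)‖ ≤ δ

/-- The positive shadowing property of a bounded linear operator. -/
def HasPositiveShadowing (T : X →L[ℂ] X) : Prop :=
  ∀ ε : ℝ, 0 < ε → ∃ δ : ℝ, 0 < δ ∧ ∀ x : ℕ → X, IsPseudoOrbit T δ x →
    ∃ y : X, ∀ n, 1 ≤ n → ‖(T ^ n) y - x n‖ ≤ ε

end Shadowing

end

/-!
A unimodular eigenvalue `c` of the adjoint of `T` obstructs positive shadowing. If `ℓ ≠ 0` and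
`ℓ ∘ T = c ℓ`, push an orbit at each step by a small vector `v` with `ℓ v ≠ 0`, rotated by powers
of `c` so that the errors add up in phase under `ℓ`: then `|ℓ|` grows linearly along this
pseudo-orbit, while it is constant along every true orbit. For `T = C_φ` with `φ α = α`, evaluation
at `α` is such an `ℓ`, with `c = 1`; it is bounded on `H^p` because `|f|^p` is dominated by its
Poisson integral.
-/

section UnimodularEigenfunctional

variable {X : Type*} [NormedAddCommGroup X] [NormedSpace ℂ X] {T : X →L[ℂ] X} {c : ℂ} {δ : ℝ}
  {v : X} {ℓ : X →L[ℂ] ℂ}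

/-- The orbit of `0` under `T` pushed by `c ^ n • v` at time `n`, that is
`∑ k ∈ Finset.range n, c ^ (n - k) • T ^ k v` at time `n`. It is the unshadowable pseudo-orbit when
`‖c‖ = 1` is an eigenvalue of the adjoint of `T`. -/
def forcedOrbit (T : X →L[ℂ] X) (c : ℂ) (v : X) : ℕ → X
  | 0 => 0
  | n + 1 => T (forcedOrbit T c v n) + c ^ (n + 1) • v

lemma isPseudoOrbit_forcedOrbit (hc : ‖c‖ = 1) (hv : ‖v‖ ≤ δ) :
    IsPseudoOrbit T δ (forcedOrbit T c v) := fun n _ => by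
  simpa [forcedOrbit, norm_smul, hc] using hv

lemma map_forcedOrbit (hℓ : ∀ x, ℓ (T x) = c * ℓ x) (n : ℕ) :
    ℓ (forcedOrbit T c v n) = n * c ^ n * ℓ v := by
  induction n with
  | zero => simp [forcedOrbit]
  | succ n ih =>
    rw [forcedOrbit, map_add, hℓ, ih, map_smul, smul_eq_mul]
    push_cast
    ring

lemma map_pow_apply_of_eigenfunctional (hℓ : ∀ x, ℓ (T x) = c * ℓ x) (n : ℕ) (x : X) :
    ℓ ((T ^ n) x) = c ^ n * ℓ x := by
  induction n with
  | zero => simp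
  | succ n ih => rw [pow_succ', mul_apply_eq_comp, hℓ, ih, pow_succ', mul_assoc]

lemma exists_norm_le_map_ne_zero (hℓ : ℓ ≠ 0) (hδ : 0 < δ) : ∃ v, ‖v‖ ≤ δ ∧ ℓ v ≠ 0 := by
  obtain ⟨u, hu⟩ := DFunLike.ne_iff.1 hℓ
  have hu_norm : ‖u‖ ≠ 0 := norm_ne_zero_iff.2 fun h => hu (by simp [h])
  refine ⟨((δ / ‖u‖ : ℝ) : ℂ) • u, ?_, ?_⟩
  · rw [norm_smul, Complex.norm_real, Real.norm_of_nonneg (by positivity),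
      div_mul_cancel₀ _ hu_norm]
  · rw [map_smul, smul_eq_mul]
    exact mul_ne_zero (Complex.ofReal_ne_zero.2 (div_ne_zero hδ.ne' hu_norm)) hu

theorem not_hasPositiveShadowing_of_unimodular_eigenfunctional (hc : ‖c‖ = 1) (hℓ₀ : ℓ ≠ 0)
    (hℓ : ∀ x, ℓ (T x) = c * ℓ x) : ¬ HasPositiveShadowing T := by
  intro hT
  obtain ⟨δ, hδ, hshadow⟩ := hT 1 one_pos
  obtain ⟨v, hvδ, hv⟩ := exists_norm_le_map_ne_zero hℓ₀ hδ
  obtain ⟨y, hy⟩ := hshadow _ (isPseudoOrbit_forcedOrbit hc hvδ)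
  have hbound : ∀ n : ℕ, 1 ≤ n → n * ‖ℓ v‖ ≤ ‖ℓ y‖ + ‖ℓ‖ := fun n hn =>
    calc n * ‖ℓ v‖ = ‖ℓ (forcedOrbit T c v n)‖ := by simp [map_forcedOrbit hℓ, hc]
      _ ≤ ‖ℓ ((T ^ n) y)‖ + ‖ℓ ((T ^ n) y - forcedOrbit T c v n)‖ := by
        rw [map_sub]
        exact norm_le_norm_add_norm_sub _ _
      _ ≤ ‖ℓ y‖ + ‖ℓ‖ := by
        refine add_le_add ?_ ?_
        · rw [map_pow_apply_of_eigenfunctional hℓ, norm_mul, norm_pow, hc, one_pow, one_mul]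
        · exact (ℓ.le_opNorm_of_le (hy n hn)).trans_eq (mul_one _)
  obtain ⟨n, hn⟩ := exists_nat_gt ((‖ℓ y‖ + ‖ℓ‖) / ‖ℓ v‖)
  have hn_pos : 0 < n := Nat.cast_pos.1 (lt_of_le_of_lt (by positivity) hn)
  rw [div_lt_iff₀ (norm_pos_iff.2 hv)] at hn
  exact (hbound n hn_pos).not_gt hn

end UnimodularEigenfunctional

namespace HardyDisc

open Filter Metric Set Topology

variable {p : ℝ} {f : ℂ → ℂ} {w : ℂ}

lemma memHardy_indicator_of_norm_le (hp : 1 ≤ p) {C : ℝ} (hf : DifferentiableOn ℂ f (ball 0 1))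
    (hC : ∀ z ∈ ball (0 : ℂ) 1, ‖f z‖ ≤ C) : MemHardy p ((ball 0 1).indicator f) := by
  refine ⟨hf.congr fun z hz => indicator_of_mem hz _, fun z hz => indicator_of_notMem hz _,
    C ^ p, ?_⟩
  rintro _ ⟨r, ⟨hr₀, hr₁⟩, rfl⟩
  rw [integralMean_indicator hr₀ hr₁]
  refine Real.circleAverage_mono_on_of_le_circle (circleIntegrable_rpow hp hf hr₀ hr₁)
    fun z hz => ?_
  exact Real.rpow_le_rpow (norm_nonneg _) (hC z (sphere_subset hr₀ hr₁ hz)) (by linarith)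

lemma rpow_norm_le_mul_hardyNorm_rpow (hp : 1 ≤ p) (hf : MemHardy p f) (hw : ‖w‖ < 1) :
    ‖f w‖ ^ p ≤ (1 + ‖w‖) / (1 - ‖w‖) * hardyNorm p f ^ p := by
  have hlim : Tendsto (fun R : ℝ => (R + ‖w‖) / (R - ‖w‖) * hardyNorm p f ^ p) (𝓝[<] 1)
      (𝓝 ((1 + ‖w‖) / (1 - ‖w‖) * hardyNorm p f ^ p)) := by
    have hcont : ContinuousAt (fun R : ℝ => (R + ‖w‖) / (R - ‖w‖) * hardyNorm p f ^ p) 1 := by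
      fun_prop (disch := linarith)
    exact hcont.tendsto.mono_left nhdsWithin_le_nhds
  refine ge_of_tendsto hlim ?_
  filter_upwards [Ioo_mem_nhdsLT hw] with R hR
  have hR₀ : 0 < R := (norm_nonneg w).trans_lt hR.1
  refine (rpow_le_integralMean hp hf.1 hR₀ hR.2 (by simpa using hR.1)).trans ?_
  exact mul_le_mul_of_nonneg_left (integralMean_le_norm hp hf hR₀ hR.2)
    (div_nonneg (by positivity) (by linarith [hR.1]))

lemma norm_le_mul_hardyNorm (hp : 1 ≤ p) (hf : MemHardy p f) (hw : ‖w‖ < 1) :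
    ‖f w‖ ≤ ((1 + ‖w‖) / (1 - ‖w‖)) ^ (1 / p) * hardyNorm p f := by
  have hp₀ : 0 < p := by linarith
  have hK : 0 ≤ (1 + ‖w‖) / (1 - ‖w‖) := div_nonneg (by positivity) (by linarith)
  rw [← Real.rpow_le_rpow_iff (norm_nonneg _)
    (mul_nonneg (Real.rpow_nonneg hK _) hardyNorm_nonneg) hp₀,
    Real.mul_rpow (Real.rpow_nonneg hK _) hardyNorm_nonneg, one_div, Real.rpow_inv_rpow hK hp₀.ne']
  exact rpow_norm_le_mul_hardyNorm_rpow hp hf hw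

namespace HardySpace

variable [hp : Fact (1 ≤ p)]

variable (p) in
/-- Evaluation at a point `w` of the disc, as a bounded linear functional on `H^p(𝔻)`. -/
noncomputable def evalCLM (hw : w ∈ ball (0 : ℂ) 1) :
    HardySpace p →L[ℂ] ℂ :=
  LinearMap.mkContinuous
    { toFun := fun f => f w
      map_add' := fun _ _ => rfl
      map_smul' := fun _ _ => rfl }
    (((1 + ‖w‖) / (1 - ‖w‖)) ^ (1 / p))
    fun f => norm_le_mul_hardyNorm hp.out f.2 (mem_ball_zero_iff.1 hw)

lemma evalCLM_apply (hw : w ∈ ball (0 : ℂ) 1) (f : HardySpace p) : evalCLM p hw f = f w := rfl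

lemma evalCLM_ne_zero (hw : w ∈ ball (0 : ℂ) 1) : evalCLM p hw ≠ 0 := by
  let one : HardySpace p := ⟨_, memHardy_indicator_of_norm_le (f := fun _ => 1) (C := 1) hp.out
    (differentiableOn_const 1) fun _ _ => norm_one.le⟩
  have h_one : evalCLM p hw one = 1 := indicator_of_mem hw fun _ => (1 : ℂ)
  exact DFunLike.ne_iff.2 ⟨one, h_one.trans_ne one_ne_zero⟩

end HardySpace

lemma compositionOperator_apply [Fact (1 ≤ p)] {φ : ℂ → ℂ}
    (hφ : DifferentiableOn ℂ φ (ball 0 1)) (hm : MapsTo φ (ball 0 1) (ball 0 1))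
    (f : HardySpace p) (hw : w ∈ ball (0 : ℂ) 1) :
    compositionOperator p φ hφ hm f w = f (φ w) :=
  indicator_of_mem hw _

end HardyDisc

theorem mainTheorem10 (p : ℝ) [Fact (1 ≤ p)] (φ : ℂ → ℂ)
    (hφ : DifferentiableOn ℂ φ (Metric.ball 0 1))
    (hm : Set.MapsTo φ (Metric.ball 0 1) (Metric.ball 0 1))
    (hfix : ∃ α ∈ Metric.ball (0 : ℂ) 1, φ α = α) :
    ¬ HasPositiveShadowing (HardyDisc.compositionOperator p φ hφ hm) := by
  obtain ⟨α, hα, hfix⟩ := hfix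
  refine not_hasPositiveShadowing_of_unimodular_eigenfunctional norm_one
    (HardyDisc.HardySpace.evalCLM_ne_zero hα) fun f => ?_
  rw [HardyDisc.HardySpace.evalCLM_apply, HardyDisc.HardySpace.evalCLM_apply,
    HardyDisc.compositionOperator_apply hφ hm f hα, hfix, one_mul]
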